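/- Let $A\in\mathbb{R}^{d\times d}$ be symmetric, $b\in\mathbb{R}^d$, $\rho>0$, and let $f(x)=\tfrac12 x^TAx+b^Tx+\tfrac{\rho}{3}\|x\|^3$, where $\|\cdot\|$ is the Euclidean norm. Let $s$ be a global minimizer of $f$ on $\mathbb{R}^d$, let $\beta\ge\|A\|_{\mathrm{op}}$ (for instance $\beta=\|A\|_{\mathrm{op}}$, the $\ell_2$ operator norm), let $\lambda_{\min}$ be the smallest eigenvalue of $A$, let $v_{\min}$ be a corresponding unit eigenvector, and suppose that $b^{(1)}:=v_{\min}^Tb\neq0$. Put $$R_\rho=\frac{\beta}{2\rho}+\sqrt{\Big(\frac{\beta}{2\rho}\Big)^2+\frac{\|b\|}{\rho}},\qquad R_{\mathrm c}=-\frac{b^TAb}{2\rho\|b\|^2}+\sqrt{\Big(\frac{b^TAb}{2\rho\|b\|^2}\Big)^2+\frac{\|b\|}{\rho}}.$$ Let $x_0=-r\,b/\|b\|$ with $0\le r\le R_{\mathrm c}$, let $0<\eta\le\frac{1}{4(\beta+\rho R_\rho)}$, and let $x_{t+1}=x_t-\eta\nabla f(x_t)$ for $t=0,1,2,\dots$.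 Let $\varepsilon>0$ and define, with $(u)_+=\max\{u,0\}$, $$\tau_{\mathrm{grow}}=6\log\Big(1+\frac{(-\lambda_{\min})_+^2}{4\rho|b^{(1)}|}\Big),\qquad \tau_{\mathrm{converge}}(\varepsilon)=6\log\Big(\frac{(\beta+2\rho\|s\|)\|s\|^2}{\varepsilon}\Big).$$ Then $f(x_t)\le f(s)+\varepsilon$ for every integer $t\ge0$ with $$t\ \ge\ \frac{\tau_{\mathrm{grow}}+\tau_{\mathrm{converge}}(\varepsilon)}{\eta}\, \min\Big\{\frac{1}{\rho\|s\|+\lambda_{\min}},\ \frac{10\|s\|^2}{\varepsilon}\Big\}.$$ -/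

import Mathlib

open scoped InnerProductSpace Gradient

noncomputable section

namespace CubicGD

variable {d : ℕ}

/-- The operator `x ↦ A x` on `ℝ^d` with the Euclidean norm; its norm is `‖A‖_op`. -/
abbrev op (A : Matrix (Fin d) (Fin d) ℝ) :
    EuclideanSpace ℝ (Fin d) →L[ℝ] EuclideanSpace ℝ (Fin d) :=
  Matrix.toEuclideanCLM (𝕜 := ℝ) A

/-- The cubic-regularized quadratic `f(x) = ½ xᵀAx + bᵀx + (ρ/3)‖x‖³`. -/
def objective (A : Matrix (Fin d) (Fin d) ℝ) (b : EuclideanSpace ℝ (Fin d)) (ρ : ℝ)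
    (x : EuclideanSpace ℝ (Fin d)) : ℝ :=
  1 / 2 * ⟪x, op A x⟫_ℝ + ⟪b, x⟫_ℝ + ρ / 3 * ‖x‖ ^ 3

/-- Gradient descent with constant step size `η` started at `x₀`:
`x_{t+1} = x_t - η ∇f(x_t)`. -/
def gradientDescent (f : EuclideanSpace ℝ (Fin d) → ℝ) (η : ℝ)
    (x₀ : EuclideanSpace ℝ (Fin d)) : ℕ → EuclideanSpace ℝ (Fin d)
  | 0 => x₀
  | t + 1 => gradientDescent f η x₀ t - η • ∇ f (gradientDescent f η x₀ t)

/-- `IsMinEigenvalue A μ`: `μ` is the smallest eigenvalue of `A`. -/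
def IsMinEigenvalue (A : Matrix (Fin d) (Fin d) ℝ) (μ : ℝ) : Prop :=
  IsLeast {μ' : ℝ | Module.End.HasEigenvalue (Matrix.toEuclideanLin A) μ'} μ

/-- The upper bound `R_ρ` on the norm of a minimizer. -/
def upperRadius (β ρ : ℝ) (b : EuclideanSpace ℝ (Fin d)) : ℝ :=
  β / (2 * ρ) + √((β / (2 * ρ)) ^ 2 + ‖b‖ / ρ)

/-- The Cauchy radius `R_c`: `-R_c b/‖b‖` minimizes the objective on the line spanned by `b`. -/
def cauchyRadius (A : Matrix (Fin d) (Fin d) ℝ) (b : EuclideanSpace ℝ (Fin d)) (ρ : ℝ) : ℝ :=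
  -⟪b, op A b⟫_ℝ / (2 * ρ * ‖b‖ ^ 2)
    + √((⟪b, op A b⟫_ℝ / (2 * ρ * ‖b‖ ^ 2)) ^ 2 + ‖b‖ / ρ)

/-- `τ_grow = 6 log (1 + (-λ_min)₊² / (4 ρ |b⁽¹⁾|))`. -/
def tauGrow (lamMin ρ b₁ : ℝ) : ℝ :=
  6 * Real.log (1 + (max (-lamMin) 0) ^ 2 / (4 * ρ * |b₁|))

/-- `τ_converge(ε) = 6 log ((β + 2ρ‖s‖) ‖s‖² / ε)`. -/
def tauConverge (β ρ normS ε : ℝ) : ℝ :=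
  6 * Real.log ((β + 2 * ρ * normS) * normS ^ 2 / ε)

end CubicGD

end

/-! In an eigenbasis of `A` the iterates have coordinates `-b i * y i`. For a start on the ray of
`-b`, three properties reproduce themselves under a step (`DescentInvariant.step`): `y ≥ 0`, the
slacks are ordered along the spectrum, and the iterate is nonpositively correlated with its
gradient. Consequently `‖x_t‖` is nondecreasing and at most `R_ρ`.

While `ρ‖x_t‖ + λ_min < -δ`, the component along `vMin` grows geometrically. Bounded by the norm, it
can do so only for logarithmically many steps (`GradientRun.neg_le_shifted`). After that, with `δ` a
third of the gap `g = ρ‖s‖ + λ_min > 0`, each step contracts the distance to `s`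
(`norm_sq_step_sub_le`). So the iterates converge to `s`, and monotonicity of the norm yields `‖x_t‖
≤ ‖s‖` for all `t`.

The contraction gives the bound with `1/g`. For the bound with `10‖s‖²/ε`, `δ` is a third of
`ε/(10‖s‖²)`: as long as the optimality gap exceeds `ε`, the squared distance to `s` drops by a
fixed amount per step, which cannot go on for long. -/

namespace CubicGD

/-! ### Scalar recursions in the eigenbasis. -/

section Coordinates

variable {ι : Type*}

/-- If `x i = -b i * y i` in an eigenbasis and `‖x‖ = n`, the `i`-th coordinate of the gradient of
the cubic model at `x` is `b i * slack lam ρ n y i`. -/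
def slack (lam : ι → ℝ) (ρ n : ℝ) (y : ι → ℝ) (i : ι) : ℝ :=
  1 - (lam i + ρ * n) * y i

/-- Positive slack in an eigendirection forces positive, and relatively larger, slack in all
directions of smaller curvature. -/
def SlackOrdered (lam : ι → ℝ) (ρ n : ℝ) (y : ι → ℝ) : Prop :=
  ∀ i j, lam i ≤ lam j → 0 < slack lam ρ n y j →
    0 < slack lam ρ n y i ∧ slack lam ρ n y j * y i ≤ slack lam ρ n y i * y j

lemma slackOrdered_const (lam : ι → ℝ) (ρ n : ℝ) {c : ℝ} (hc : 0 ≤ c) :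
    SlackOrdered lam ρ n (fun _ => c) := by
  intro i j hij hj
  have h : slack lam ρ n (fun _ => c) j ≤ slack lam ρ n (fun _ => c) i := by
    unfold slack
    nlinarith
  exact ⟨hj.trans_le h, mul_le_mul_of_nonneg_right h hc⟩

lemma step_pos {lam : ι → ℝ} {ρ n η : ℝ} {y : ι → ℝ} {i : ι} (hη : 0 < η)
    (hy : 0 ≤ y i) (hl : η * (lam i + ρ * n) ≤ 1) :
    0 < y i + η * slack lam ρ n y i := by
  unfold slack
  nlinarith [mul_nonneg hy (sub_nonneg.2 hl)]

lemma slack_step (lam : ι → ℝ) (ρ n n' η : ℝ) (y : ι → ℝ) (i : ι) :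
    slack lam ρ n' (fun i => y i + η * slack lam ρ n y i) i =
      (1 - η * (lam i + ρ * n)) * slack lam ρ n y i
        - ρ * (n' - n) * (y i + η * slack lam ρ n y i) := by
  unfold slack
  ring

/-- The ordering compares the ratios slack/`y`. A step multiplies each slack by a factor that
decreases with the curvature, and the growth of the norm then subtracts one common constant from all
the new ratios. -/
lemma SlackOrdered.step {lam : ι → ℝ} {ρ n n' η : ℝ} {y : ι → ℝ} (hρ : 0 ≤ ρ) (hη : 0 < η)
    (hy : ∀ i, 0 ≤ y i) (hl : ∀ i, η * (lam i + ρ * n) ≤ 1) (hn : n ≤ n')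
    (h : SlackOrdered lam ρ n y) :
    SlackOrdered lam ρ n' (fun i => y i + η * slack lam ρ n y i) := by
  intro i j hij hj
  rw [slack_step] at hj
  rw [slack_step, slack_step]
  beta_reduce
  have hyi := step_pos (ρ := ρ) (n := n) hη (hy i) (hl i)
  have hyj := step_pos (ρ := ρ) (n := n) hη (hy j) (hl j)
  have hai : 0 ≤ 1 - η * (lam i + ρ * n) := by linarith [hl i]
  have haj : 0 ≤ 1 - η * (lam j + ρ * n) := by linarith [hl j]
  have haij : 1 - η * (lam j + ρ * n) ≤ 1 - η * (lam i + ρ * n) := by nlinarith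
  have hc : 0 ≤ ρ * (n' - n) := mul_nonneg hρ (by linarith)
  have hjpos : 0 < slack lam ρ n y j := by
    by_contra hneg
    nlinarith [mul_nonneg hc hyj.le, mul_nonneg haj (neg_nonneg.2 (not_lt.1 hneg))]
  obtain ⟨hipos, hle⟩ := h i j hij hjpos
  generalize slack lam ρ n y i = hi at *
  generalize slack lam ρ n y j = hj' at *
  generalize ρ * (n' - n) = c at *
  generalize 1 - η * (lam i + ρ * n) = ai at *
  generalize 1 - η * (lam j + ρ * n) = aj at *
  have h1 : hj' * (y i + η * hi) ≤ hi * (y j + η * hj') := by nlinarith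
  have h2 : aj * (hj' * (y i + η * hi)) ≤ ai * (hi * (y j + η * hj')) :=
    mul_le_mul haij h1 (mul_nonneg hjpos.le hyi.le) hai
  have h3 : (aj * hj' - c * (y j + η * hj')) * (y i + η * hi)
      ≤ (ai * hi - c * (y i + η * hi)) * (y j + η * hj') := by nlinarith
  refine ⟨?_, h3⟩
  have h4 : 0 < (ai * hi - c * (y i + η * hi)) * (y j + η * hj') :=
    (mul_pos hj hyi).trans_le h3
  exact pos_of_mul_pos_left h4 hyj.le

/-- A single eigenvalue separates positive from nonpositive slacks, as a Chebyshev-type comparison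
of weighted sums requires. -/
lemma SlackOrdered.exists_threshold [Fintype ι] [Nonempty ι] {lam : ι → ℝ} {ρ n : ℝ} {y : ι → ℝ}
    (h : SlackOrdered lam ρ n y) :
    ∃ k, ∀ i, (0 < slack lam ρ n y i → lam i ≤ lam k) ∧
      (slack lam ρ n y i ≤ 0 → lam k ≤ lam i) := by
  classical
  by_cases hne : ∃ i, 0 < slack lam ρ n y i
  · obtain ⟨i₀, hi₀⟩ := hne
    obtain ⟨k, hk, hmax⟩ := Finset.exists_max_image
      (Finset.univ.filter fun i => 0 < slack lam ρ n y i) lam ⟨i₀, by simpa using hi₀⟩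
    refine ⟨k, fun i => ⟨fun hi => hmax i (by simpa using hi), fun hi => ?_⟩⟩
    by_contra hlt
    exact absurd (h i k (not_le.1 hlt).le (by simpa using hk)).1 (not_lt.2 hi)
  · obtain ⟨k, hk⟩ := Finite.exists_min lam
    exact ⟨k, fun i => ⟨fun hi => absurd ⟨i, hi⟩ hne, fun _ => hk i⟩⟩

lemma norm_le_norm_step [Fintype ι] {lam B y : ι → ℝ} {ρ n n' η : ℝ} (hη : 0 < η)
    (hB : ∀ i, 0 ≤ B i) (hn' : 0 ≤ n')
    (hnsq : n ^ 2 = ∑ i, B i * y i ^ 2)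
    (hnsq' : n' ^ 2 = ∑ i, B i * (y i + η * slack lam ρ n y i) ^ 2)
    (hsum : 0 ≤ ∑ i, B i * (y i * slack lam ρ n y i)) : n ≤ n' := by
  have : n ^ 2 ≤ n' ^ 2 := by
    have h : n' ^ 2 = n ^ 2 + 2 * η * ∑ i, B i * (y i * slack lam ρ n y i)
        + ∑ i, B i * (η * slack lam ρ n y i) ^ 2 := by
      rw [hnsq, hnsq', Finset.mul_sum, ← Finset.sum_add_distrib, ← Finset.sum_add_distrib]
      exact Finset.sum_congr rfl fun i _ => by ring
    have h2 : 0 ≤ ∑ i, B i * (η * slack lam ρ n y i) ^ 2 :=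
      Finset.sum_nonneg fun i _ => mul_nonneg (hB i) (sq_nonneg _)
    have := mul_nonneg (mul_nonneg zero_le_two hη.le) hsum
    linarith
  exact le_of_sq_le_sq this hn'

lemma SlackOrdered.sum_step_nonneg [Fintype ι] {lam B y : ι → ℝ} {ρ n n' η : ℝ}
    (hρ : 0 ≤ ρ) (hη : 0 < η) (hB : ∀ i, 0 ≤ B i) (hy : ∀ i, 0 ≤ y i) (hn : 0 ≤ n) (hn' : 0 ≤ n')
    (hnsq : n ^ 2 = ∑ i, B i * y i ^ 2)
    (hnsq' : n' ^ 2 = ∑ i, B i * (y i + η * slack lam ρ n y i) ^ 2)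
    (hl : ∀ i, η * (lam i + ρ * n + 2 * ρ * n') ≤ 1)
    (h : SlackOrdered lam ρ n y) (hsum : 0 ≤ ∑ i, B i * (y i * slack lam ρ n y i)) :
    0 ≤ ∑ i, B i * ((y i + η * slack lam ρ n y i) *
      slack lam ρ n' (fun i => y i + η * slack lam ρ n y i) i) := by
  rcases isEmpty_or_nonempty ι with hι | hι
  · simp
  obtain ⟨k, hk⟩ := h.exists_threshold
  -- `κ = ρ n'² / (n' + n)` trades the increment of the norm for that of its square, which is a sum
  -- over coordinates.
  obtain ⟨κ, hκ₀, hκ₁, hκ⟩ : ∃ κ, 0 ≤ κ ∧ κ ≤ ρ * n' ∧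
      ρ * (n' - n) * n' ^ 2 = κ * (n' ^ 2 - n ^ 2) := by
    rcases hn'.eq_or_lt with h0 | hpos
    · exact ⟨0, le_rfl, by simp [← h0], by simp [← h0]⟩
    · have hs : 0 < n' + n := by linarith
      refine ⟨ρ * n' * (n' / (n' + n)), by positivity, ?_, by field_simp; ring⟩
      exact mul_le_of_le_one_right (by positivity) ((div_le_one hs).2 (by linarith))
  have hl' : ∀ i, 0 ≤ 1 - η * (lam i + ρ * n) - 2 * (κ * η) := fun i => by
    nlinarith [hl i, mul_le_mul_of_nonneg_right hκ₁ hη.le]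
  have hκη : 0 ≤ κ * η := mul_nonneg hκ₀ hη.le
  have key : ∑ i, B i * ((y i + η * slack lam ρ n y i) *
      slack lam ρ n' (fun i => y i + η * slack lam ρ n y i) i) =
      ∑ i, B i * (slack lam ρ n y i * ((y i + η * slack lam ρ n y i) *
        (1 - η * (lam i + ρ * n) - κ * η) - κ * η * y i)) := by
    have e1 : ∑ i, B i * ((y i + η * slack lam ρ n y i) *
        slack lam ρ n' (fun i => y i + η * slack lam ρ n y i) i) =
        ∑ i, B i * ((y i + η * slack lam ρ n y i) *
          ((1 - η * (lam i + ρ * n)) * slack lam ρ n y i)) - ρ * (n' - n) * n' ^ 2 := by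
      rw [hnsq', Finset.mul_sum, ← Finset.sum_sub_distrib]
      exact Finset.sum_congr rfl fun i _ => by rw [slack_step]; ring
    rw [e1, hκ, hnsq, hnsq', ← Finset.sum_sub_distrib, Finset.mul_sum, ← Finset.sum_sub_distrib]
    exact Finset.sum_congr rfl fun i _ => by ring
  rw [key]
  -- The new sum dominates, term by term, the old one times the multiplier at the threshold `k`: on
  -- either side of `k` the sign of the slack matches the direction of the inequality.
  refine (mul_nonneg (hl' k) hsum).trans ?_
  rw [Finset.mul_sum]
  refine Finset.sum_le_sum fun i _ => ?_
  rw [mul_left_comm]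
  refine mul_le_mul_of_nonneg_left ?_ (hB i)
  have hyi := (step_pos (ρ := ρ) (n := n) hη (hy i)
    (by nlinarith [hl' i])).le
  have hyi0 := hy i
  have hi' := hl' i
  have hk' := hl' k
  rcases lt_or_ge 0 (slack lam ρ n y i) with hpos | hneg
  · have hle := (hk i).1 hpos
    have h1 : 1 - η * (lam k + ρ * n) - κ * η ≤ 1 - η * (lam i + ρ * n) - κ * η := by nlinarith
    have h2 : y i ≤ y i + η * slack lam ρ n y i := by nlinarith
    have h3 := mul_le_mul h2 h1 (by linarith) hyi
    nlinarith [mul_le_mul_of_nonneg_left h3 hpos.le]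
  · have hle := (hk i).2 hneg
    have h1 : 1 - η * (lam i + ρ * n) - κ * η ≤ 1 - η * (lam k + ρ * n) - κ * η := by nlinarith
    have h2 : y i + η * slack lam ρ n y i ≤ y i := by nlinarith
    have h3 := mul_le_mul h2 h1 (by linarith) hyi0
    nlinarith [mul_le_mul_of_nonpos_left h3 hneg]

end Coordinates

/-! ### The cubic model and its gradient. -/

section Model

variable {E : Type*} [NormedAddCommGroup E] [InnerProductSpace ℝ E]

/-- The cubic model `½⟪x, T x⟫ + ⟪b, x⟫ + (ρ/3)‖x‖³` of a bounded operator `T`. -/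
noncomputable def cubicModel (T : E →L[ℝ] E) (b : E) (ρ : ℝ) (x : E) : ℝ :=
  1 / 2 * ⟪x, T x⟫_ℝ + ⟪b, x⟫_ℝ + ρ / 3 * ‖x‖ ^ 3

/-- The gradient of `cubicModel T b ρ` for symmetric `T`. -/
noncomputable def cubicGrad (T : E →L[ℝ] E) (b : E) (ρ : ℝ) (x : E) : E :=
  T x + b + (ρ * ‖x‖) • x

lemma hasFDerivAt_norm_cube (x : E) :
    HasFDerivAt (fun x : E => ‖x‖ ^ 3) ((3 * ‖x‖) • innerSL ℝ x) x := by
  have h := hasFDerivAt_norm_rpow x (p := 3) (by norm_num)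
  have e : (3 : ℝ) - 2 = 1 := by norm_num
  rw [e, Real.rpow_one] at h
  refine h.congr_of_eventuallyEq (Filter.Eventually.of_forall fun y => ?_)
  simp

lemma hasGradientAt_cubicModel [CompleteSpace E] {T : E →L[ℝ] E}
    (hT : ∀ x y, ⟪T x, y⟫_ℝ = ⟪x, T y⟫_ℝ) (b : E) (ρ : ℝ) (x : E) :
    HasGradientAt (cubicModel T b ρ) (cubicGrad T b ρ x) x := by
  rw [hasGradientAt_iff_hasFDerivAt]
  have h1 : HasFDerivAt (fun x => ⟪x, T x⟫_ℝ) _ x :=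
    (hasFDerivAt_id x).inner ℝ T.hasFDerivAt
  have h2 : HasFDerivAt (fun x => ⟪b, x⟫_ℝ) (innerSL ℝ b) x := (innerSL ℝ b).hasFDerivAt
  have h := ((h1.const_mul (1 / 2)).add h2).add ((hasFDerivAt_norm_cube x).const_mul (ρ / 3))
  refine h.congr_fderiv ?_
  ext y
  have := hT x y
  have := real_inner_comm (T x) y
  simp only [cubicGrad, map_add, map_smul, InnerProductSpace.toDual_apply_apply, fderivInnerCLM_apply,
    add_apply, smul_apply, innerSL_apply_apply, smul_eq_mul,
    ContinuousLinearMap.comp_apply, ContinuousLinearMap.prod_apply, ContinuousLinearMap.id_apply, id_eq]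
  linarith

/-- Writing `⟪x, p⟫` through norms makes the remainder of the cube an exact polynomial in `‖x‖` and
`‖x + p‖`, with double root at equal norms. -/
lemma cubicModel_add {T : E →L[ℝ] E} (hT : ∀ x y, ⟪T x, y⟫_ℝ = ⟪x, T y⟫_ℝ) (b : E) (ρ : ℝ)
    (x p : E) :
    cubicModel T b ρ (x + p) = cubicModel T b ρ x + ⟪cubicGrad T b ρ x, p⟫_ℝ
      + 1 / 2 * (⟪p, T p⟫_ℝ + ρ * ‖x‖ * ‖p‖ ^ 2)
      + ρ / 6 * (‖x + p‖ - ‖x‖) ^ 2 * (2 * ‖x + p‖ + ‖x‖) := by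
  have h1 := norm_add_sq_real x p
  have h2 := hT x p
  have h3 := real_inner_comm p (T x)
  unfold cubicModel cubicGrad
  simp only [map_add, inner_add_left, inner_add_right, inner_smul_left, RCLike.conj_to_real]
  have h4 : ⟪x, p⟫_ℝ = (‖x + p‖ ^ 2 - ‖x‖ ^ 2 - ‖p‖ ^ 2) / 2 := by linarith
  rw [h4, ← h3, h2]
  ring

/-- Stationarity of `s` eliminates `b`; what remains is `T` shifted by the average of `ρ‖x‖` and
`ρ‖s‖`, plus a nonnegative term. -/
lemma inner_sub_cubicGrad {T : E →L[ℝ] E} {b : E} {ρ : ℝ} {s : E} (hs : cubicGrad T b ρ s = 0)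
    (x : E) :
    ⟪x - s, cubicGrad T b ρ x⟫_ℝ = ⟪x - s, T (x - s)⟫_ℝ + ρ / 2 * (‖x‖ + ‖s‖) * ‖x - s‖ ^ 2
      + ρ / 2 * (‖s‖ - ‖x‖) ^ 2 * (‖x‖ + ‖s‖) := by
  have hb : b = -T s - (ρ * ‖s‖) • s := by
    rw [← sub_eq_zero, ← hs, cubicGrad]
    abel
  have h1 := norm_sub_sq_real x s
  have h2 := real_inner_comm x s
  have hx := real_inner_self_eq_norm_sq x
  have hs' := real_inner_self_eq_norm_sq s
  have h3 : ⟪x, s⟫_ℝ = (‖x‖ ^ 2 + ‖s‖ ^ 2 - ‖x - s‖ ^ 2) / 2 := by linarith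
  rw [cubicGrad, hb]
  simp only [map_sub, inner_add_right, inner_sub_left, inner_sub_right, inner_neg_right,
    inner_smul_right, hx, hs', h2, h3]
  ring

lemma cubicGrad_eq_add {T : E →L[ℝ] E} {b : E} {ρ : ℝ} {s : E} (hs : cubicGrad T b ρ s = 0)
    (x : E) :
    cubicGrad T b ρ x = (T (x - s) + (ρ / 2 * (‖x‖ + ‖s‖)) • (x - s))
      + (ρ / 2 * (‖x‖ - ‖s‖)) • (x + s) := by
  have hb : b = -T s - (ρ * ‖s‖) • s := by
    rw [← sub_eq_zero, ← hs, cubicGrad]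
    abel
  rw [cubicGrad, hb, map_sub]
  module

lemma cubicGrad_eq_zero_of_isMinOn [CompleteSpace E] {T : E →L[ℝ] E}
    (hT : ∀ x y, ⟪T x, y⟫_ℝ = ⟪x, T y⟫_ℝ) {b : E} {ρ : ℝ} {s : E}
    (hs : ∀ x, cubicModel T b ρ s ≤ cubicModel T b ρ x) : cubicGrad T b ρ s = 0 := by
  have h1 : fderiv ℝ (cubicModel T b ρ) s = 0 :=
    IsLocalMin.fderiv_eq_zero (Filter.Eventually.of_forall hs)
  rw [← (hasGradientAt_cubicModel hT b ρ s).gradient, gradient, h1, map_zero]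

/-- At a global minimizer the shifted operator `T + ρ‖s‖` is positive on an eigenvector of `T` that
is not orthogonal to `b`. -/
lemma shifted_eigenvalue_pos [CompleteSpace E] {T : E →L[ℝ] E}
    (hT : ∀ x y, ⟪T x, y⟫_ℝ = ⟪x, T y⟫_ℝ) {b : E} {ρ : ℝ} {s : E}
    (hs : ∀ x, cubicModel T b ρ s ≤ cubicModel T b ρ x) {v : E} (hv : ‖v‖ = 1) {μ : ℝ}
    (hTv : T v = μ • v) (hb : ⟪v, b⟫_ℝ ≠ 0) : 0 < ρ * ‖s‖ + μ := by
  have hg := cubicGrad_eq_zero_of_isMinOn hT hs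
  have h1 : (ρ * ‖s‖ + μ) * ⟪v, s⟫_ℝ = -⟪v, b⟫_ℝ := by
    have h := congrArg (fun z => ⟪v, z⟫_ℝ) hg
    simp only [cubicGrad, inner_add_right, inner_smul_right, ← hT, hTv, inner_smul_left,
      inner_zero_right, RCLike.conj_to_real] at h
    linarith
  have hne : (ρ * ‖s‖ + μ) * ⟪v, s⟫_ℝ ≠ 0 := by rw [h1]; exact neg_ne_zero.2 hb
  have hvs : ⟪v, s⟫_ℝ ≠ 0 := right_ne_zero_of_mul hne
  have hv1 : ⟪v, v⟫_ℝ = 1 := by rw [real_inner_self_eq_norm_sq, hv, one_pow]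
  -- Reflecting `s` in the hyperplane orthogonal to `v` keeps its norm, so the cubic remainder
  -- vanishes and minimality gives `0 ≤ ρ‖s‖ + μ`. Stationarity, with `b` not orthogonal to `v`,
  -- excludes equality.
  have hnorm : ‖s + (-2 * ⟪v, s⟫_ℝ) • v‖ = ‖s‖ := by
    rw [← sq_eq_sq₀ (norm_nonneg _) (norm_nonneg _), norm_add_sq_real, norm_smul, hv,
      inner_smul_right, real_inner_comm v s, Real.norm_eq_abs, mul_one, sq_abs]
    ring
  have h2 := cubicModel_add hT b ρ s ((-2 * ⟪v, s⟫_ℝ) • v)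
  rw [hnorm, hg, map_smul, hTv, norm_smul, hv, inner_zero_left, inner_smul_left, inner_smul_right,
    inner_smul_right, hv1, Real.norm_eq_abs, mul_one, mul_one, sq_abs, RCLike.conj_to_real] at h2
  have h3 := hs (s + (-2 * ⟪v, s⟫_ℝ) • v)
  have h4 : 0 ≤ (ρ * ‖s‖ + μ) * (2 * ⟪v, s⟫_ℝ ^ 2) := by nlinarith
  have h5 : 0 < 2 * ⟪v, s⟫_ℝ ^ 2 := by positivity
  exact lt_of_le_of_ne (nonneg_of_mul_nonneg_left h4 h5) (left_ne_zero_of_mul hne).symm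

lemma abs_inner_apply_le {T : E →L[ℝ] E} {β : ℝ} (hβ : ‖T‖ ≤ β) (x : E) :
    |⟪x, T x⟫_ℝ| ≤ β * ‖x‖ ^ 2 := by
  have h1 := abs_real_inner_le_norm x (T x)
  have h2 := T.le_of_opNorm_le hβ x
  nlinarith [mul_le_mul_of_nonneg_left h2 (norm_nonneg x)]

lemma sqrt_quadratic_root {a c : ℝ} (hc : 0 ≤ c) :
    (a + √(a ^ 2 + c)) ^ 2 = 2 * a * (a + √(a ^ 2 + c)) + c := by
  have := Real.sq_sqrt (show 0 ≤ a ^ 2 + c by positivity)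
  nlinarith

lemma le_quadratic_root {a c r : ℝ} (h : r ^ 2 ≤ 2 * a * r + c) : r ≤ a + √(a ^ 2 + c) := by
  have : r - a ≤ √(a ^ 2 + c) := Real.le_sqrt_of_sq_le (by nlinarith)
  linarith

lemma quadratic_le_of_le_root {a c r : ℝ} (hc : 0 ≤ c) (hr : 0 ≤ r)
    (h : r ≤ a + √(a ^ 2 + c)) : r ^ 2 ≤ 2 * a * r + c := by
  have h0 : √(a ^ 2) ≤ √(a ^ 2 + c) := Real.sqrt_le_sqrt (by linarith)
  rw [Real.sqrt_sq_eq_abs] at h0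
  have h1 := Real.sq_sqrt (show 0 ≤ a ^ 2 + c by positivity)
  have h2 : |r - a| ≤ √(a ^ 2 + c) :=
    abs_le.2 ⟨by linarith [le_abs_self a], by linarith⟩
  have h3 := sq_le_sq' (by linarith [abs_nonneg (r - a)]) h2
  rw [sq_abs] at h3
  nlinarith

/-- The hypothesis forces `ρ‖x‖³ ≤ β‖x‖² + ‖b‖‖x‖`. It serves both the iterates and `s`. -/
lemma norm_le_of_inner_cubicGrad_nonpos {T : E →L[ℝ] E} {b : E} {ρ β : ℝ} (hρ : 0 < ρ)
    (hβ : ‖T‖ ≤ β) {x : E} (hx : ⟪x, cubicGrad T b ρ x⟫_ℝ ≤ 0) :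
    ‖x‖ ≤ β / (2 * ρ) + √((β / (2 * ρ)) ^ 2 + ‖b‖ / ρ) := by
  apply le_quadratic_root
  simp only [cubicGrad, inner_add_right, inner_smul_right, real_inner_self_eq_norm_sq] at hx
  have h1 := (abs_le.1 (abs_inner_apply_le hβ x)).1
  have h2 := (abs_le.1 (abs_real_inner_le_norm x b)).1
  rcases (norm_nonneg x).eq_or_lt with h0 | hpos
  · rw [← h0]
    have : 0 ≤ ‖b‖ / ρ := by positivity
    simpa using this
  · have h3 : ‖x‖ * (ρ * ‖x‖ ^ 2) ≤ ‖x‖ * (β * ‖x‖ + ‖b‖) := by nlinarith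
    have h4 := le_of_mul_le_mul_left h3 hpos
    have h5 : 2 * (β / (2 * ρ)) * ‖x‖ + ‖b‖ / ρ = (β * ‖x‖ + ‖b‖) / ρ := by field_simp
    rw [h5, le_div_iff₀ hρ]
    linarith

lemma norm_cubicGrad_le {T : E →L[ℝ] E} {b : E} {ρ β : ℝ} (hρ : 0 < ρ) (hβ : ‖T‖ ≤ β) (x : E) :
    ‖cubicGrad T b ρ x‖ ≤ β * ‖x‖ + ‖b‖ + ρ * ‖x‖ ^ 2 := by
  refine (norm_add₃_le).trans ?_
  have h2 := T.le_of_opNorm_le hβ x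
  rw [norm_smul, Real.norm_of_nonneg (by positivity)]
  nlinarith

/-- Sufficient decrease of a gradient step. -/
lemma cubicModel_step_le {T : E →L[ℝ] E} (hT : ∀ x y, ⟪T x, y⟫_ℝ = ⟪x, T y⟫_ℝ) {b : E}
    {ρ β R η : ℝ} (hρ : 0 < ρ) (hβ : ‖T‖ ≤ β) (hη : 0 < η) (hηR : 4 * η * (β + ρ * R) ≤ 1)
    {x : E} (hx : ‖x‖ ≤ R) (hx' : ‖x - η • cubicGrad T b ρ x‖ ≤ R) :
    cubicModel T b ρ (x - η • cubicGrad T b ρ x) + 3 / 4 * η * ‖cubicGrad T b ρ x‖ ^ 2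
      ≤ cubicModel T b ρ x := by
  have h := cubicModel_add hT b ρ x (-(η • cubicGrad T b ρ x))
  rw [← sub_eq_add_neg] at h
  set G := cubicGrad T b ρ x with hG
  have hn : ‖-(η • G)‖ = η * ‖G‖ := by rw [norm_neg, norm_smul, Real.norm_of_nonneg hη.le]
  have hd : (‖x - η • G‖ - ‖x‖) ^ 2 ≤ (η * ‖G‖) ^ 2 := by
    rw [← hn]
    refine sq_le_sq.2 ?_
    rw [abs_of_nonneg (norm_nonneg (-(η • G)))]
    have := abs_norm_sub_norm_le (x - η • G) x
    rwa [sub_sub_cancel_left] at this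
  have h1 := (abs_le.1 (abs_inner_apply_le hβ (-(η • G)))).2
  rw [hn] at h h1
  rw [inner_neg_right, inner_smul_right, real_inner_self_eq_norm_sq] at h
  have hβ0 : 0 ≤ β := (norm_nonneg T).trans hβ
  have hR : 0 ≤ R := (norm_nonneg x).trans hx
  have h2 : ρ * ‖x‖ * (η * ‖G‖) ^ 2 ≤ ρ * R * (η * ‖G‖) ^ 2 := by gcongr
  have h3 : ρ / 6 * (‖x - η • G‖ - ‖x‖) ^ 2 * (2 * ‖x - η • G‖ + ‖x‖)
      ≤ ρ / 6 * (η * ‖G‖) ^ 2 * (2 * R + R) := by gcongr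
  have h4 : η * ‖G‖ ^ 2 * (η * (β + 2 * ρ * R)) ≤ η * ‖G‖ ^ 2 * (1 / 2) := by
    refine mul_le_mul_of_nonneg_left ?_ (by positivity)
    nlinarith [mul_nonneg hη.le hβ0]
  nlinarith

end Model

/-! ### The descent invariant and the contraction step. -/

section Eigenbasis

variable {E : Type*} [NormedAddCommGroup E] [InnerProductSpace ℝ E] {ι : Type*} [Fintype ι]
  {T : E →L[ℝ] E} {e : OrthonormalBasis ι ℝ E} {lam : ι → ℝ} {b : E} {ρ : ℝ}

lemma norm_sq_eq_sum (e : OrthonormalBasis ι ℝ E) (x : E) : ‖x‖ ^ 2 = ∑ i, ⟪e i, x⟫_ℝ ^ 2 := by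
  simpa using (e.sum_sq_norm_inner_right x).symm

lemma inner_eq_sum (e : OrthonormalBasis ι ℝ E) (x y : E) :
    ⟪x, y⟫_ℝ = ∑ i, ⟪e i, x⟫_ℝ * ⟪e i, y⟫_ℝ := by
  simpa only [real_inner_comm x] using (e.sum_inner_mul_inner x y).symm

lemma inner_eigenvector_apply (hT : ∀ x y, ⟪T x, y⟫_ℝ = ⟪x, T y⟫_ℝ)
    {v : E} {μ : ℝ} (hv : T v = μ • v) (x : E) : ⟪v, T x⟫_ℝ = μ * ⟪v, x⟫_ℝ := by
  rw [← hT, hv, inner_smul_left, RCLike.conj_to_real]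

lemma mul_norm_sq_le_inner_apply (hT : ∀ x y, ⟪T x, y⟫_ℝ = ⟪x, T y⟫_ℝ)
    (he : ∀ i, T (e i) = lam i • e i) {m : ℝ} (hm : ∀ i, m ≤ lam i) (x : E) :
    m * ‖x‖ ^ 2 ≤ ⟪x, T x⟫_ℝ := by
  rw [norm_sq_eq_sum e, inner_eq_sum e, Finset.mul_sum]
  refine Finset.sum_le_sum fun i _ => ?_
  rw [inner_eigenvector_apply hT (he i)]
  nlinarith [mul_le_mul_of_nonneg_right (hm i) (sq_nonneg ⟪e i, x⟫_ℝ)]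

lemma norm_sq_shifted_apply_le (hT : ∀ x y, ⟪T x, y⟫_ℝ = ⟪x, T y⟫_ℝ)
    (he : ∀ i, T (e i) = lam i • e i) {c L : ℝ} (h0 : ∀ i, 0 ≤ lam i + c)
    (hL : ∀ i, lam i + c ≤ L) (x : E) :
    ‖T x + c • x‖ ^ 2 ≤ L * (⟪x, T x⟫_ℝ + c * ‖x‖ ^ 2) := by
  rw [norm_sq_eq_sum e, norm_sq_eq_sum e, inner_eq_sum e, Finset.mul_sum, ← Finset.sum_add_distrib,
    Finset.mul_sum]
  refine Finset.sum_le_sum fun i _ => ?_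
  rw [inner_add_right, inner_smul_right, inner_eigenvector_apply hT (he i)]
  have := mul_le_mul_of_nonneg_right (hL i) (mul_nonneg (h0 i) (sq_nonneg ⟪e i, x⟫_ℝ))
  nlinarith

lemma eigenvalue_le (he : ∀ i, T (e i) = lam i • e i) {β : ℝ} (hβ : ‖T‖ ≤ β) (i : ι) :
    lam i ≤ β := by
  have := (abs_le.1 (abs_inner_apply_le hβ (e i))).2
  simpa [he, inner_smul_right] using this

/-- The property of the iterates that drives the analysis: in the eigenbasis `x i = -b i * y i` with
`y ≥ 0` and ordered slacks, and `x` is nonpositively correlated with the gradient at `x`. -/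
def DescentInvariant (e : OrthonormalBasis ι ℝ E) (lam : ι → ℝ) (b : E) (ρ : ℝ) (x : E) : Prop :=
  ∃ y : ι → ℝ, (∀ i, ⟪e i, x⟫_ℝ = -(⟪e i, b⟫_ℝ * y i)) ∧ (∀ i, 0 ≤ y i) ∧
    SlackOrdered lam ρ ‖x‖ y ∧ 0 ≤ ∑ i, ⟪e i, b⟫_ℝ ^ 2 * (y i * slack lam ρ ‖x‖ y i)

lemma inner_cubicGrad_coord (hT : ∀ x y, ⟪T x, y⟫_ℝ = ⟪x, T y⟫_ℝ)
    (he : ∀ i, T (e i) = lam i • e i) {x : E} {y : ι → ℝ} {i : ι}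
    (hx : ⟪e i, x⟫_ℝ = -(⟪e i, b⟫_ℝ * y i)) :
    ⟪e i, cubicGrad T b ρ x⟫_ℝ = ⟪e i, b⟫_ℝ * slack lam ρ ‖x‖ y i := by
  rw [cubicGrad, inner_add_right, inner_add_right, inner_smul_right,
    inner_eigenvector_apply hT (he i), hx, slack]
  ring

lemma inner_cubicGrad_eq_neg_sum (hT : ∀ x y, ⟪T x, y⟫_ℝ = ⟪x, T y⟫_ℝ)
    (he : ∀ i, T (e i) = lam i • e i) {x : E} {y : ι → ℝ}
    (hx : ∀ i, ⟪e i, x⟫_ℝ = -(⟪e i, b⟫_ℝ * y i)) :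
    ⟪x, cubicGrad T b ρ x⟫_ℝ = -∑ i, ⟪e i, b⟫_ℝ ^ 2 * (y i * slack lam ρ ‖x‖ y i) := by
  rw [inner_eq_sum e, ← Finset.sum_neg_distrib]
  refine Finset.sum_congr rfl fun i _ => ?_
  rw [inner_cubicGrad_coord hT he (hx i), hx i]
  ring

lemma DescentInvariant.inner_cubicGrad_nonpos (hT : ∀ x y, ⟪T x, y⟫_ℝ = ⟪x, T y⟫_ℝ)
    (he : ∀ i, T (e i) = lam i • e i) {x : E} (h : DescentInvariant e lam b ρ x) :
    ⟪x, cubicGrad T b ρ x⟫_ℝ ≤ 0 := by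
  obtain ⟨y, hx, -, -, hsum⟩ := h
  rw [inner_cubicGrad_eq_neg_sum hT he hx]
  linarith

lemma DescentInvariant.inner_nonpos {x : E} (h : DescentInvariant e lam b ρ x) :
    ⟪b, x⟫_ℝ ≤ 0 := by
  obtain ⟨y, hx, hy, -, -⟩ := h
  rw [inner_eq_sum e]
  refine Finset.sum_nonpos fun i _ => ?_
  rw [hx i]
  nlinarith [mul_nonneg (sq_nonneg ⟪e i, b⟫_ℝ) (hy i)]

/-- The model equals `½⟪x, ∇f(x)⟫ + ½⟪b, x⟫ - (ρ/6)‖x‖³`. -/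
lemma DescentInvariant.cubicModel_nonpos (hT : ∀ x y, ⟪T x, y⟫_ℝ = ⟪x, T y⟫_ℝ)
    (he : ∀ i, T (e i) = lam i • e i) (hρ : 0 ≤ ρ) {x : E} (h : DescentInvariant e lam b ρ x) :
    cubicModel T b ρ x ≤ 0 := by
  have h1 := h.inner_cubicGrad_nonpos hT he
  have h2 := h.inner_nonpos
  rw [cubicGrad, inner_add_right, inner_add_right, inner_smul_right, real_inner_self_eq_norm_sq,
    real_inner_comm b x] at h1
  have : 0 ≤ ρ * ‖x‖ ^ 3 := by positivity
  unfold cubicModel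
  nlinarith

/-- On this ray, `⟪x, ∇f(x)⟫` is a nonnegative multiple of a quadratic in `r` whose positive root is
the Cauchy radius. -/
lemma descentInvariant_start (hT : ∀ x y, ⟪T x, y⟫_ℝ = ⟪x, T y⟫_ℝ)
    (he : ∀ i, T (e i) = lam i • e i) (hρ : 0 < ρ) (hb : b ≠ 0) {r : ℝ} (hr₀ : 0 ≤ r)
    (hr : r ≤ -⟪b, T b⟫_ℝ / (2 * ρ * ‖b‖ ^ 2)
      + √((⟪b, T b⟫_ℝ / (2 * ρ * ‖b‖ ^ 2)) ^ 2 + ‖b‖ / ρ)) :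
    DescentInvariant e lam b ρ (-(r / ‖b‖) • b) := by
  have hb' : 0 < ‖b‖ := norm_pos_iff.2 hb
  have hx : ∀ i, ⟪e i, -(r / ‖b‖) • b⟫_ℝ = -(⟪e i, b⟫_ℝ * (r / ‖b‖)) := fun i => by
    rw [inner_smul_right]
    ring
  refine ⟨fun _ => r / ‖b‖, hx, fun _ => by positivity, slackOrdered_const _ _ _ (by positivity), ?_⟩
  have h1 := inner_cubicGrad_eq_neg_sum (ρ := ρ) hT he (y := fun _ => r / ‖b‖) hx
  rw [neg_div, ← neg_sq (⟪b, T b⟫_ℝ / _)] at hr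
  have h2 := quadratic_le_of_le_root (by positivity) hr₀ hr
  have hn : ‖-(r / ‖b‖) • b‖ = r := by
    rw [norm_smul, norm_neg, Real.norm_of_nonneg (by positivity), div_mul_cancel₀ _ hb'.ne']
  rw [← neg_nonpos, ← h1, cubicGrad, hn, map_smul, inner_add_right, inner_add_right,
    inner_smul_right, inner_smul_right, inner_smul_left, inner_smul_left, inner_smul_left,
    inner_smul_right, real_inner_self_eq_norm_sq, RCLike.conj_to_real]
  have h3 : ρ * ‖b‖ ^ 2 * r ^ 2 ≤ -⟪b, T b⟫_ℝ * r + ‖b‖ ^ 3 := by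
    have e1 : 2 * -(⟪b, T b⟫_ℝ / (2 * ρ * ‖b‖ ^ 2)) * r + ‖b‖ / ρ
        = (-⟪b, T b⟫_ℝ * r + ‖b‖ ^ 3) / (ρ * ‖b‖ ^ 2) := by
      field_simp
    rw [e1, le_div_iff₀ (by positivity)] at h2
    linarith
  have e2 : -(r / ‖b‖) * (-(r / ‖b‖) * ⟪b, T b⟫_ℝ) + -(r / ‖b‖) * ‖b‖ ^ 2 +
      ρ * r * (-(r / ‖b‖) * (-(r / ‖b‖) * ‖b‖ ^ 2))
      = r / ‖b‖ ^ 2 * (ρ * ‖b‖ ^ 2 * r ^ 2 - (-⟪b, T b⟫_ℝ * r + ‖b‖ ^ 3)) := by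
    field_simp
    ring
  rw [e2]
  exact mul_nonpos_of_nonneg_of_nonpos (by positivity) (by linarith)

/-- A crude bound that avoids circularity: the new iterate is known to have norm at most `R` only
once it satisfies the invariant. -/
lemma norm_step_le (hρ : 0 < ρ) {β R η : ℝ} (hβ : ‖T‖ ≤ β) (hη : 0 < η)
    (hηR : 4 * η * (β + ρ * R) ≤ 1) (hR : ρ * R ^ 2 = β * R + ‖b‖) {x : E} (hx : ‖x‖ ≤ R) :
    ‖x - η • cubicGrad T b ρ x‖ ≤ 3 / 2 * R := by
  have hβ0 : 0 ≤ β := (norm_nonneg T).trans hβ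
  have hR0 : 0 ≤ R := (norm_nonneg x).trans hx
  have h1 : ‖cubicGrad T b ρ x‖ ≤ β * R + ‖b‖ + ρ * R ^ 2 :=
    (norm_cubicGrad_le hρ hβ x).trans (by gcongr)
  have h2 := norm_sub_le x (η • cubicGrad T b ρ x)
  rw [norm_smul, Real.norm_of_nonneg hη.le] at h2
  have h3 := mul_le_mul_of_nonneg_left h1 hη.le
  nlinarith [mul_le_mul_of_nonneg_right hηR hR0, mul_nonneg (mul_nonneg hη.le hβ0) hR0]

lemma DescentInvariant.step (hT : ∀ x y, ⟪T x, y⟫_ℝ = ⟪x, T y⟫_ℝ)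
    (he : ∀ i, T (e i) = lam i • e i) (hρ : 0 < ρ) {β R η : ℝ} (hβ : ‖T‖ ≤ β) (hη : 0 < η)
    (hηR : 4 * η * (β + ρ * R) ≤ 1) (hR : ρ * R ^ 2 = β * R + ‖b‖) {x : E} (hxR : ‖x‖ ≤ R)
    (h : DescentInvariant e lam b ρ x) :
    DescentInvariant e lam b ρ (x - η • cubicGrad T b ρ x) ∧
      ‖x‖ ≤ ‖x - η • cubicGrad T b ρ x‖ := by
  have hstep := norm_step_le hρ hβ hη hηR hR hxR
  obtain ⟨y, hx, hy, hord, hsum⟩ := h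
  have hx' : ∀ i, ⟪e i, x - η • cubicGrad T b ρ x⟫_ℝ
      = -(⟪e i, b⟫_ℝ * (y i + η * slack lam ρ ‖x‖ y i)) := fun i => by
    rw [inner_sub_right, inner_smul_right, inner_cubicGrad_coord hT he (hx i), hx i]
    ring
  have hn : ‖x‖ ^ 2 = ∑ i, ⟪e i, b⟫_ℝ ^ 2 * y i ^ 2 := by
    rw [norm_sq_eq_sum e]
    exact Finset.sum_congr rfl fun i _ => by rw [hx i]; ring
  have hn' : ‖x - η • cubicGrad T b ρ x‖ ^ 2
      = ∑ i, ⟪e i, b⟫_ℝ ^ 2 * (y i + η * slack lam ρ ‖x‖ y i) ^ 2 := by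
    rw [norm_sq_eq_sum e]
    exact Finset.sum_congr rfl fun i _ => by rw [hx' i]; ring
  -- The sum in parentheses is at most `β + ρR + 3ρR ≤ 4(β + ρR)`.
  have hl : ∀ i, η * (lam i + ρ * ‖x‖ + 2 * ρ * ‖x - η • cubicGrad T b ρ x‖) ≤ 1 := fun i => by
    have h1 := eigenvalue_le he hβ i
    have h2 : ρ * ‖x‖ ≤ ρ * R := by gcongr
    have h3 : 2 * ρ * ‖x - η • cubicGrad T b ρ x‖ ≤ 2 * ρ * (3 / 2 * R) := by gcongr
    have hβ0 : 0 ≤ β := (norm_nonneg T).trans hβ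
    nlinarith
  have hl' : ∀ i, η * (lam i + ρ * ‖x‖) ≤ 1 := fun i => by
    have : 0 ≤ η * (2 * ρ * ‖x - η • cubicGrad T b ρ x‖) := by positivity
    linarith [hl i]
  have hmono := norm_le_norm_step hη (fun i => sq_nonneg ⟪e i, b⟫_ℝ) (norm_nonneg _) hn hn' hsum
  refine ⟨⟨_, hx', fun i => (step_pos hη (hy i) (hl' i)).le, hord.step hρ.le hη hy hl' hmono, ?_⟩,
    hmono⟩
  exact hord.sum_step_nonneg hρ.le hη (fun i => sq_nonneg _) hy (norm_nonneg _) (norm_nonneg _)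
    hn hn' hl hsum

/-- One gradient step contracts the distance to the minimizer once the shifted operator
`T + ρ‖x‖` is almost positive. -/
lemma norm_sq_step_sub_le (hT : ∀ x y, ⟪T x, y⟫_ℝ = ⟪x, T y⟫_ℝ)
    (he : ∀ i, T (e i) = lam i • e i) (hρ : 0 < ρ) {β R η : ℝ} (hβ : ‖T‖ ≤ β) (hη : 0 < η)
    (hηR : 4 * η * (β + ρ * R) ≤ 1) {s : E} (hs : cubicGrad T b ρ s = 0) (hsR : ‖s‖ ≤ R)
    {m : ℝ} (hm : ∀ i, m ≤ lam i) (hg : 0 < ρ * ‖s‖ + m) {x : E} (hxR : ‖x‖ ≤ R)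
    (hx : -((ρ * ‖s‖ + m) / 3) ≤ ρ * ‖x‖ + m) :
    ‖x - η • cubicGrad T b ρ x - s‖ ^ 2 ≤ (1 - η * (ρ * ‖s‖ + m) / 2) * ‖x - s‖ ^ 2 := by
  have hβ0 : 0 ≤ β := (norm_nonneg T).trans hβ
  set c := ρ / 2 * (‖x‖ + ‖s‖) with hc
  set G := cubicGrad T b ρ x with hG
  have hcL : c ≤ ρ * R := by
    rw [hc]
    nlinarith
  have hMw := norm_sq_shifted_apply_le (c := c) (L := β + ρ * R) hT he
    (fun i => by linarith [hm i]) (fun i => by linarith [eigenvalue_le he hβ i]) (x - s)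
  have hray := mul_norm_sq_le_inner_apply hT he hm (x - s)
  have hin := inner_sub_cubicGrad hs x
  have hdec := cubicGrad_eq_add hs x
  rw [← hc, ← hG] at hin hdec
  have hu : ‖(ρ / 2 * (‖x‖ - ‖s‖)) • (x + s)‖ ^ 2
      ≤ ρ * R * (ρ / 2 * (‖s‖ - ‖x‖) ^ 2 * (‖x‖ + ‖s‖)) := by
    rw [norm_smul, mul_pow, Real.norm_eq_abs, sq_abs]
    have h1 : ‖x + s‖ ^ 2 ≤ (‖x‖ + ‖s‖) * (2 * R) := by
      rw [sq]
      exact mul_le_mul (norm_add_le x s) ((norm_add_le x s).trans (by linarith)) (norm_nonneg _)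
        (by positivity)
    calc (ρ / 2 * (‖x‖ - ‖s‖)) ^ 2 * ‖x + s‖ ^ 2
        ≤ (ρ / 2 * (‖x‖ - ‖s‖)) ^ 2 * ((‖x‖ + ‖s‖) * (2 * R)) := by gcongr
      _ = ρ * R * (ρ / 2 * (‖s‖ - ‖x‖) ^ 2 * (‖x‖ + ‖s‖)) := by ring
  have hq : 0 ≤ ρ / 2 * (‖s‖ - ‖x‖) ^ 2 * (‖x‖ + ‖s‖) := by positivity
  -- Cocoercivity towards `s`: both pieces of the gradient have squared norm at most `β + ρR` times
  -- their share of `⟪x - s, G⟫`.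
  have hGsq : ‖G‖ ^ 2 ≤ 2 * (β + ρ * R) * ⟪x - s, G⟫_ℝ := by
    have h2 : ‖G‖ ^ 2 ≤ 2 * (‖T (x - s) + c • (x - s)‖ ^ 2
        + ‖(ρ / 2 * (‖x‖ - ‖s‖)) • (x + s)‖ ^ 2) := by
      rw [hdec]
      refine (pow_le_pow_left₀ (norm_nonneg _) (norm_add_le _ _) 2).trans ?_
      exact add_sq_le
    rw [hin]
    nlinarith [mul_nonneg hβ0 hq]
  have hlow : (ρ * ‖s‖ + m) / 3 * ‖x - s‖ ^ 2 ≤ ⟪x - s, G⟫_ℝ := by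
    -- `m + c` is the mean of `ρ‖x‖ + m ≥ -g/3` and `g = ρ‖s‖ + m`, hence at least `g/3`.
    have h3 : (ρ * ‖s‖ + m) / 3 * ‖x - s‖ ^ 2 ≤ (m + c) * ‖x - s‖ ^ 2 := by
      gcongr
      linarith
    rw [hin]
    linarith
  have hpos : 0 ≤ ⟪x - s, G⟫_ℝ := le_trans (by positivity) hlow
  have hexp : ‖x - η • G - s‖ ^ 2 = ‖x - s‖ ^ 2 - 2 * η * ⟪x - s, G⟫_ℝ + η ^ 2 * ‖G‖ ^ 2 := by
    rw [sub_right_comm, norm_sub_sq_real, inner_smul_right, norm_smul, mul_pow, Real.norm_eq_abs,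
      sq_abs]
    ring
  have h4 : η ^ 2 * ‖G‖ ^ 2 ≤ η * (1 / 2 * ⟪x - s, G⟫_ℝ) := by
    have h5 := mul_le_mul_of_nonneg_left hGsq hη.le
    have h6 := mul_le_mul_of_nonneg_right hηR hpos
    rw [sq, mul_assoc]
    refine mul_le_mul_of_nonneg_left ?_ hη.le
    linarith
  rw [hexp]
  nlinarith [mul_le_mul_of_nonneg_left hlow hη.le]

end Eigenbasis

lemma norm_sq_sub_le_of_norm_le {E : Type*} [SeminormedAddCommGroup E] {x s : E} (h : ‖x‖ ≤ ‖s‖) :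
    ‖x - s‖ ^ 2 ≤ 4 * ‖s‖ ^ 2 := by
  have h1 : ‖x - s‖ ≤ 2 * ‖s‖ := (norm_sub_le _ _).trans (by linarith)
  nlinarith [norm_nonneg (x - s)]

/-! ### Global analysis of a run: growth, containment and the two rates. -/

section Run

variable {E : Type*} [NormedAddCommGroup E] [InnerProductSpace ℝ E]

lemma cubicModel_eq_of_cubicGrad_eq_zero {T : E →L[ℝ] E} (hT : ∀ x y, ⟪T x, y⟫_ℝ = ⟪x, T y⟫_ℝ)
    {b : E} {ρ : ℝ} {s : E} (hs : cubicGrad T b ρ s = 0) (x : E) :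
    cubicModel T b ρ x = cubicModel T b ρ s
      + 1 / 2 * (⟪x - s, T (x - s)⟫_ℝ + ρ * ‖s‖ * ‖x - s‖ ^ 2)
      + ρ / 6 * (‖x‖ - ‖s‖) ^ 2 * (2 * ‖x‖ + ‖s‖) := by
  have h := cubicModel_add hT b ρ s (x - s)
  rwa [add_sub_cancel, hs, inner_zero_left, add_zero] at h

lemma cubicModel_le_of_norm_le {T : E →L[ℝ] E} (hT : ∀ x y, ⟪T x, y⟫_ℝ = ⟪x, T y⟫_ℝ)
    {b : E} {ρ β : ℝ} (hρ : 0 < ρ) (hβ : ‖T‖ ≤ β) {s : E} (hs : cubicGrad T b ρ s = 0) {x : E}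
    (hx : ‖x‖ ≤ ‖s‖) :
    cubicModel T b ρ x ≤ cubicModel T b ρ s + 1 / 2 * (β + 2 * ρ * ‖s‖) * ‖x - s‖ ^ 2 := by
  rw [cubicModel_eq_of_cubicGrad_eq_zero hT hs]
  have h1 := (abs_le.1 (abs_inner_apply_le hβ (x - s))).2
  have h2 : (‖x‖ - ‖s‖) ^ 2 ≤ ‖x - s‖ ^ 2 := by
    rw [sq_le_sq, abs_of_nonneg (norm_nonneg (x - s))]
    exact abs_norm_sub_norm_le x s
  have h3 : ρ / 6 * (‖x‖ - ‖s‖) ^ 2 * (2 * ‖x‖ + ‖s‖)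
      ≤ ρ / 6 * ‖x - s‖ ^ 2 * (2 * ‖s‖ + ‖s‖) := by gcongr
  linarith

variable {ι : Type*} [Fintype ι]

/-- `x` is a run of gradient descent on `cubicModel T b ρ` with step size `η` that starts on the ray
spanned by `-b` at a point satisfying the descent invariant. The operator `T` is diagonalized by `e`
with eigenvalues `lam`. -/
structure GradientRun (T : E →L[ℝ] E) (e : OrthonormalBasis ι ℝ E) (lam : ι → ℝ) (b : E)
    (ρ β R η : ℝ) (x : ℕ → E) : Prop where
  symm : ∀ x y, ⟪T x, y⟫_ℝ = ⟪x, T y⟫_ℝ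
  apply_basis : ∀ i, T (e i) = lam i • e i
  ρ_pos : 0 < ρ
  opNorm_le : ‖T‖ ≤ β
  radius_eq : R = β / (2 * ρ) + √((β / (2 * ρ)) ^ 2 + ‖b‖ / ρ)
  η_pos : 0 < η
  η_le : 4 * η * (β + ρ * R) ≤ 1
  start : DescentInvariant e lam b ρ (x 0)
  start_eq : ∃ c : ℝ, 0 ≤ c ∧ x 0 = -c • b
  step : ∀ t, x (t + 1) = x t - η • cubicGrad T b ρ (x t)

namespace GradientRun

variable {T : E →L[ℝ] E} {e : OrthonormalBasis ι ℝ E} {lam : ι → ℝ} {b : E} {ρ β R η : ℝ}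
  {x : ℕ → E}

lemma β_nonneg (h : GradientRun T e lam b ρ β R η x) : 0 ≤ β := (norm_nonneg T).trans h.opNorm_le

lemma norm_le_radius (h : GradientRun T e lam b ρ β R η x) {z : E}
    (hz : ⟪z, cubicGrad T b ρ z⟫_ℝ ≤ 0) : ‖z‖ ≤ R := by
  rw [h.radius_eq]
  exact norm_le_of_inner_cubicGrad_nonpos h.ρ_pos h.opNorm_le hz

lemma radius_quadratic (h : GradientRun T e lam b ρ β R η x) : ρ * R ^ 2 = β * R + ‖b‖ := by
  have hρ := h.ρ_pos
  have h1 := sqrt_quadratic_root (a := β / (2 * ρ)) (c := ‖b‖ / ρ) (by positivity)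
  rw [← h.radius_eq] at h1
  rw [h1]
  field_simp

lemma invariant (h : GradientRun T e lam b ρ β R η x) (t : ℕ) :
    DescentInvariant e lam b ρ (x t) := by
  induction t with
  | zero => exact h.start
  | succ t ih =>
    rw [h.step]
    exact (ih.step h.symm h.apply_basis h.ρ_pos h.opNorm_le h.η_pos h.η_le h.radius_quadratic
      (h.norm_le_radius (ih.inner_cubicGrad_nonpos h.symm h.apply_basis))).1

lemma norm_le (h : GradientRun T e lam b ρ β R η x) (t : ℕ) : ‖x t‖ ≤ R :=
  h.norm_le_radius ((h.invariant t).inner_cubicGrad_nonpos h.symm h.apply_basis)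

lemma norm_monotone (h : GradientRun T e lam b ρ β R η x) : Monotone fun t => ‖x t‖ := by
  refine monotone_nat_of_le_succ fun t => ?_
  rw [h.step]
  exact ((h.invariant t).step h.symm h.apply_basis h.ρ_pos h.opNorm_le h.η_pos h.η_le
    h.radius_quadratic (h.norm_le t)).2

/-- The component along an eigenvector grows geometrically while `ρ‖x‖ + m < -δ`. -/
lemma pow_le_of_shifted_lt (h : GradientRun T e lam b ρ β R η x) {v : E} {m : ℝ}
    (hTv : T v = m • v) (hb : ⟪v, b⟫_ℝ ≠ 0) {δ : ℝ} (hδ : 0 < δ) {t : ℕ}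
    (ht : ρ * ‖x t‖ + m < -δ) :
    (1 + η * δ) ^ t ≤ 1 + δ * (-⟪v, x t⟫_ℝ / ⟪v, b⟫_ℝ) := by
  have hη := h.η_pos
  have hstep : ∀ k, -⟪v, x (k + 1)⟫_ℝ / ⟪v, b⟫_ℝ
      = (1 - η * (ρ * ‖x k‖ + m)) * (-⟪v, x k⟫_ℝ / ⟪v, b⟫_ℝ) + η := fun k => by
    rw [h.step, cubicGrad, inner_sub_right, inner_smul_right, inner_add_right, inner_add_right,
      inner_smul_right, inner_eigenvector_apply h.symm hTv]
    field_simp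
    ring
  -- Norms are monotone, so the shift is below `-δ` at all earlier steps too, and each multiplies `1
  -- + δY` by at least `1 + ηδ`.
  have key : ∀ k ≤ t, (1 + η * δ) ^ k ≤ 1 + δ * (-⟪v, x k⟫_ℝ / ⟪v, b⟫_ℝ) := by
    intro k
    induction k with
    | zero =>
      intro _
      obtain ⟨c, hc, hx0⟩ := h.start_eq
      rw [hx0, inner_smul_right]
      have : -(-c * ⟪v, b⟫_ℝ) / ⟪v, b⟫_ℝ = c := by field_simp
      rw [this, pow_zero]
      nlinarith
    | succ k ih =>
      intro hk
      have ih' := ih (by omega)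
      have hmono : ρ * ‖x k‖ ≤ ρ * ‖x t‖ :=
        mul_le_mul_of_nonneg_left (h.norm_monotone (by omega)) h.ρ_pos.le
      have hone : 1 ≤ (1 + η * δ) ^ k := one_le_pow₀ (by nlinarith [mul_pos hη hδ])
      have hY : 0 ≤ -⟪v, x k⟫_ℝ / ⟪v, b⟫_ℝ := by
        by_contra hneg
        nlinarith [mul_neg_of_pos_of_neg hδ (not_le.1 hneg)]
      rw [hstep, pow_succ]
      generalize -⟪v, x k⟫_ℝ / ⟪v, b⟫_ℝ = Y at *
      have h1 : (1 + η * δ) * Y ≤ (1 - η * (ρ * ‖x k‖ + m)) * Y := by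
        refine mul_le_mul_of_nonneg_right ?_ hY
        nlinarith
      have h2 := mul_le_mul_of_nonneg_right ih' (by positivity : 0 ≤ 1 + η * δ)
      nlinarith [mul_le_mul_of_nonneg_left h1 hδ.le]
  exact key t le_rfl

/-- Within `(2/(ηδ)) log (1 + (-m)₊²/(4ρ|⟪v, b⟫|))` steps the norm grows to `(-m - δ)/ρ`. -/
lemma neg_le_shifted (h : GradientRun T e lam b ρ β R η x) {v : E} (hv : ‖v‖ = 1) {m : ℝ}
    (hTv : T v = m • v) (hb : ⟪v, b⟫_ℝ ≠ 0) {δ : ℝ} (hδ : 0 < δ) (hηδ : η * δ ≤ 1) {t : ℕ}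
    (ht : 2 * Real.log (1 + (max (-m) 0) ^ 2 / (4 * ρ * |⟪v, b⟫_ℝ|)) / (η * δ) ≤ t) :
    -δ ≤ ρ * ‖x t‖ + m := by
  by_contra hlt
  rw [not_le] at hlt
  have hρ := h.ρ_pos
  have hu : 0 < η * δ := mul_pos h.η_pos hδ
  have hbpos : 0 < |⟪v, b⟫_ℝ| := abs_pos.2 hb
  have hm : max (-m) 0 = -m := max_eq_left (by nlinarith [norm_nonneg (x t)])
  have h1 := h.pow_le_of_shifted_lt hTv hb hδ hlt
  have h2 : -⟪v, x t⟫_ℝ / ⟪v, b⟫_ℝ ≤ ‖x t‖ / |⟪v, b⟫_ℝ| := by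
    refine (le_abs_self _).trans ?_
    rw [abs_div, abs_neg]
    gcongr
    simpa [hv] using abs_real_inner_le_norm v (x t)
  have h3 : δ * (‖x t‖ / |⟪v, b⟫_ℝ|) < (-m) ^ 2 / (4 * ρ * |⟪v, b⟫_ℝ|) := by
    rw [← mul_div_assoc, div_lt_div_iff₀ hbpos (by positivity)]
    -- From `ρ‖x‖ < -m - δ` and `4δ(-m - δ) ≤ m²`; hence the `4ρ` in `τ_grow`.
    have : δ * ‖x t‖ * (4 * ρ) < (-m) ^ 2 := by
      nlinarith [mul_lt_mul_of_pos_left hlt hδ, sq_nonneg (m + 2 * δ)]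
    nlinarith
  have h4 : (1 + η * δ) ^ t < 1 + (max (-m) 0) ^ 2 / (4 * ρ * |⟪v, b⟫_ℝ|) := by
    rw [hm]
    have := mul_le_mul_of_nonneg_left h2 hδ.le
    linarith
  have h5 := Real.log_lt_log (by positivity) h4
  rw [Real.log_pow] at h5
  have h6 : η * δ / 2 ≤ Real.log (1 + η * δ) := by
    refine le_trans ?_ (Real.le_log_one_add_of_nonneg hu.le)
    rw [div_le_div_iff₀ (by norm_num) (by positivity)]
    nlinarith
  rw [div_le_iff₀ hu] at ht
  have := mul_le_mul_of_nonneg_left h6 (Nat.cast_nonneg (α := ℝ) t)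
  linarith

variable {s : E} {m : ℝ}

/-- A run longer than the two stages splits into a growth stage and `k` further steps. -/
lemma exists_growth_stage (h : GradientRun T e lam b ρ β R η x) {v : E} (hv : ‖v‖ = 1)
    (hTv : T v = m • v) (hb : ⟪v, b⟫_ℝ ≠ 0) {g l : ℝ} (hg : 0 < g) (hηg : η * g ≤ 1)
    (hl : 1 ≤ 6 * l) {t : ℕ}
    (ht : 6 * (Real.log (1 + (max (-m) 0) ^ 2 / (4 * ρ * |⟪v, b⟫_ℝ|)) + l) / (η * g) ≤ t) :
    ∃ t₀ k, t = t₀ + k ∧ -(g / 3) ≤ ρ * ‖x t₀‖ + m ∧ 6 * l - η * g ≤ k * (η * g) := by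
  have hρ := h.ρ_pos
  have hpos : 0 < η * g := mul_pos h.η_pos hg
  have hL : 0 ≤ Real.log (1 + (max (-m) 0) ^ 2 / (4 * ρ * |⟪v, b⟫_ℝ|)) :=
    Real.log_nonneg (le_add_of_nonneg_right (by positivity))
  have hgrow := fun k : ℕ =>
    h.neg_le_shifted hv hTv hb (δ := g / 3) (t := k) (by positivity) (by linarith)
  generalize Real.log (1 + (max (-m) 0) ^ 2 / (4 * ρ * |⟪v, b⟫_ℝ|)) = L at *
  -- Rounding up costs at most one step, the `-η * g` in the conclusion. Taking `δ = g/3` turns the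
  -- factor 2 into 6.
  have ht₀ : (⌈6 * L / (η * g)⌉₊ : ℝ) < 6 * L / (η * g) + 1 := Nat.ceil_lt_add_one (by positivity)
  have ht₀' : 6 * L / (η * g) ≤ ⌈6 * L / (η * g)⌉₊ := Nat.le_ceil _
  generalize ⌈6 * L / (η * g)⌉₊ = t₀ at *
  have heq : 2 * L / (η * (g / 3)) = 6 * L / (η * g) := by
    have := h.η_pos
    field_simp
    ring
  have ht₁ : (t₀ : ℝ) * (η * g) < 6 * L + η * g := by
    have := mul_lt_mul_of_pos_right ht₀ hpos
    rwa [add_mul, div_mul_cancel₀ _ hpos.ne', one_mul] at this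
  rw [div_le_iff₀ hpos] at ht
  have hle : t₀ ≤ t := by
    have : (t₀ : ℝ) * (η * g) ≤ t * (η * g) := by linarith
    exact_mod_cast le_of_mul_le_mul_right this hpos
  obtain ⟨k, rfl⟩ := Nat.exists_eq_add_of_le hle
  push_cast at ht
  exact ⟨t₀, k, rfl, hgrow t₀ (heq.trans_le ht₀'), by linarith⟩

lemma norm_minimizer_le (h : GradientRun T e lam b ρ β R η x) (hs : cubicGrad T b ρ s = 0) :
    ‖s‖ ≤ R :=
  h.norm_le_radius (by rw [hs, inner_zero_right])

lemma η_mul_gap_le (h : GradientRun T e lam b ρ β R η x) (hs : cubicGrad T b ρ s = 0)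
    {v : E} (hv : ‖v‖ = 1) (hTv : T v = m • v) : η * (ρ * ‖s‖ + m) ≤ 1 / 4 := by
  have h1 : m ≤ β := by
    have := (abs_le.1 (abs_inner_apply_le h.opNorm_le v)).2
    simpa [hTv, inner_smul_right, hv] using this
  have h2 := mul_le_mul_of_nonneg_left (h.norm_minimizer_le hs) h.ρ_pos.le
  have h3 := mul_le_mul_of_nonneg_left (add_le_add h2 h1) h.η_pos.le
  linarith [h.η_le]

lemma norm_sq_sub_le_pow (h : GradientRun T e lam b ρ β R η x) (hs : cubicGrad T b ρ s = 0)
    (hm : ∀ i, m ≤ lam i) (hg : 0 < ρ * ‖s‖ + m) (hηg : η * (ρ * ‖s‖ + m) ≤ 1) {t₀ : ℕ}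
    (ht₀ : -((ρ * ‖s‖ + m) / 3) ≤ ρ * ‖x t₀‖ + m) (k : ℕ) :
    ‖x (t₀ + k) - s‖ ^ 2 ≤ (1 - η * (ρ * ‖s‖ + m) / 2) ^ k * ‖x t₀ - s‖ ^ 2 := by
  induction k with
  | zero => simp
  | succ k ih =>
    have hmono : ρ * ‖x t₀‖ ≤ ρ * ‖x (t₀ + k)‖ :=
      mul_le_mul_of_nonneg_left (h.norm_monotone (by omega)) h.ρ_pos.le
    have h1 := norm_sq_step_sub_le h.symm h.apply_basis h.ρ_pos h.opNorm_le h.η_pos h.η_le hs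
      (h.norm_minimizer_le hs) hm hg (h.norm_le (t₀ + k)) (by linarith)
    rw [← h.step] at h1
    refine h1.trans ?_
    rw [pow_succ' (1 - _), mul_assoc]
    exact mul_le_mul_of_nonneg_left ih (by linarith)

/-- The iterates stay in the ball whose radius is the norm of the minimizer. -/
lemma norm_le_norm_minimizer (h : GradientRun T e lam b ρ β R η x) (hs : cubicGrad T b ρ s = 0)
    (hm : ∀ i, m ≤ lam i) (hg : 0 < ρ * ‖s‖ + m) {v : E} (hv : ‖v‖ = 1) (hTv : T v = m • v)
    (hb : ⟪v, b⟫_ℝ ≠ 0) (t : ℕ) : ‖x t‖ ≤ ‖s‖ := by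
  have hηg := h.η_mul_gap_le hs hv hTv
  obtain ⟨t₀, ht₀⟩ := exists_nat_ge
    (2 * Real.log (1 + (max (-m) 0) ^ 2 / (4 * ρ * |⟪v, b⟫_ℝ|)) / (η * ((ρ * ‖s‖ + m) / 3)))
  have hpos := mul_pos h.η_pos hg
  have hsh := h.neg_le_shifted hv hTv hb (by positivity) (by linarith) ht₀
  have hpow := h.norm_sq_sub_le_pow hs hm hg (by linarith) hsh
  -- Convergence to `s` with nondecreasing norms bounds every norm by the limit `‖s‖`.
  have hlim : Filter.Tendsto (fun k => ‖x (t₀ + k) - s‖ ^ 2) Filter.atTop (nhds 0) := by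
    refine squeeze_zero (fun _ => by positivity) hpow ?_
    have := (tendsto_pow_atTop_nhds_zero_of_lt_one (r := 1 - η * (ρ * ‖s‖ + m) / 2)
      (by linarith) (by linarith)).mul_const (‖x t₀ - s‖ ^ 2)
    rwa [zero_mul] at this
  have hlim' : Filter.Tendsto (fun k => x (t₀ + k)) Filter.atTop (nhds s) := by
    rw [tendsto_iff_norm_sub_tendsto_zero]
    simpa using hlim.sqrt
  have hmono : Monotone fun k => ‖x (t₀ + k)‖ := fun i j hij => h.norm_monotone (by omega)
  exact (h.norm_monotone (by omega : t ≤ t₀ + t)).trans (hmono.ge_of_tendsto hlim'.norm t)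

/-- Comparison with the origin; since iterates have nonpositive value, it settles every `ε` that is
at least half of `(β + 2ρ‖s‖)‖s‖²`. -/
lemma neg_cubicModel_minimizer_le (h : GradientRun T e lam b ρ β R η x)
    (hs : cubicGrad T b ρ s = 0) :
    0 ≤ cubicModel T b ρ s + 1 / 2 * ((β + 2 * ρ * ‖s‖) * ‖s‖ ^ 2) := by
  have := cubicModel_le_of_norm_le h.symm h.ρ_pos h.opNorm_le hs (x := 0) (by simp)
  simp only [zero_sub, norm_neg] at this
  have h0 : cubicModel T b ρ 0 = 0 := by simp [cubicModel]
  linarith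

/-- Linear rate of convergence. -/
lemma cubicModel_le_of_linear_rate (h : GradientRun T e lam b ρ β R η x)
    (hs : cubicGrad T b ρ s = 0) (hm : ∀ i, m ≤ lam i) (hg : 0 < ρ * ‖s‖ + m) {v : E}
    (hv : ‖v‖ = 1) (hTv : T v = m • v) (hb : ⟪v, b⟫_ℝ ≠ 0) {ε : ℝ} (hε : 0 < ε)
    (hεK : 2 * ε < (β + 2 * ρ * ‖s‖) * ‖s‖ ^ 2) {t : ℕ}
    (ht : 6 * (Real.log (1 + (max (-m) 0) ^ 2 / (4 * ρ * |⟪v, b⟫_ℝ|)) +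
      Real.log ((β + 2 * ρ * ‖s‖) * ‖s‖ ^ 2 / ε)) / (η * (ρ * ‖s‖ + m)) ≤ t) :
    cubicModel T b ρ (x t) ≤ cubicModel T b ρ s + ε := by
  have hηg := h.η_mul_gap_le hs hv hTv
  have hx := h.norm_le_norm_minimizer hs hm hg hv hTv hb
  have hρ := h.ρ_pos
  have hβ := h.β_nonneg
  set K := (β + 2 * ρ * ‖s‖) * ‖s‖ ^ 2 with hK
  set g := ρ * ‖s‖ + m
  -- Since `K > 2ε`, the logarithm is at least `log 2`, enough to absorb the rounding loss and the
  -- extra factor 2 in `hexp`.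
  have hl : Real.log 2 ≤ Real.log (K / ε) :=
    Real.log_le_log (by norm_num) ((le_div_iff₀ hε).2 hεK.le)
  have hl2 := Real.log_two_gt_d9
  obtain ⟨t₀, k, rfl, hsh, hk⟩ :=
    h.exists_growth_stage hv hTv hb hg (by linarith) (by linarith) ht
  have hpow := h.norm_sq_sub_le_pow hs hm hg (by linarith) hsh k
  have h0 := norm_sq_sub_le_of_norm_le (hx t₀)
  have hexp : (1 - η * g / 2) ^ k ≤ ε / K / 2 := by
    have h1 : (1 - η * g / 2) ^ k ≤ Real.exp (-(η * g / 2)) ^ k :=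
      pow_le_pow_left₀ (by linarith) (Real.one_sub_le_exp_neg _) k
    refine h1.trans ?_
    rw [← Real.exp_nat_mul]
    have h2 : ε / K / 2 = Real.exp (-Real.log (K / ε) - Real.log 2) := by
      rw [Real.exp_sub, Real.exp_neg, Real.exp_log (div_pos (by linarith) hε),
        Real.exp_log (by norm_num), inv_div]
    rw [h2]
    apply Real.exp_le_exp.2
    linarith
  have hK0 : 0 < K := by linarith
  have hmodel := cubicModel_le_of_norm_le h.symm hρ h.opNorm_le hs (hx (t₀ + k))
  have h3 : ‖x (t₀ + k) - s‖ ^ 2 ≤ ε / K / 2 * (4 * ‖s‖ ^ 2) :=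
    hpow.trans (mul_le_mul hexp h0 (by positivity) (by positivity))
  have h4 : 1 / 2 * (β + 2 * ρ * ‖s‖) * ‖x (t₀ + k) - s‖ ^ 2
      ≤ 1 / 2 * (β + 2 * ρ * ‖s‖) * (ε / K / 2 * (4 * ‖s‖ ^ 2)) := by gcongr
  have h5 : 1 / 2 * (β + 2 * ρ * ‖s‖) * (ε / K / 2 * (4 * ‖s‖ ^ 2)) = ε := by
    have : 1 / 2 * (β + 2 * ρ * ‖s‖) * (ε / K / 2 * (4 * ‖s‖ ^ 2)) = ε / K * K := by
      rw [hK]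
      ring
    rw [this, div_mul_cancel₀ _ hK0.ne']
  linarith

lemma cubicModel_step_add_le (h : GradientRun T e lam b ρ β R η x) (t : ℕ) :
    cubicModel T b ρ (x (t + 1)) + 3 / 4 * η * ‖cubicGrad T b ρ (x t)‖ ^ 2
      ≤ cubicModel T b ρ (x t) := by
  have hR := h.norm_le (t + 1)
  rw [h.step] at hR ⊢
  exact cubicModel_step_le h.symm h.ρ_pos h.opNorm_le h.η_pos h.η_le (h.norm_le t) hR

lemma cubicModel_antitone (h : GradientRun T e lam b ρ β R η x) :
    Antitone fun t => cubicModel T b ρ (x t) := by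
  refine antitone_nat_of_succ_le fun t => ?_
  have := h.cubicModel_step_add_le t
  have h2 : 0 ≤ 3 / 4 * η * ‖cubicGrad T b ρ (x t)‖ ^ 2 := by
    have := h.η_pos
    positivity
  linarith

/-- While the optimality gap exceeds `ε`, the squared distance to the minimizer decreases by a fixed
amount. -/
lemma norm_sq_sub_succ_le (h : GradientRun T e lam b ρ β R η x) (hs : cubicGrad T b ρ s = 0)
    (hmin : ∀ z, cubicModel T b ρ s ≤ cubicModel T b ρ z) (hm : ∀ i, m ≤ lam i)
    (hx : ∀ t, ‖x t‖ ≤ ‖s‖) {ε δ : ℝ} (hδ : 0 ≤ δ) (hδε : 30 * δ * ‖s‖ ^ 2 ≤ ε) {t : ℕ}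
    (hsh : -δ ≤ ρ * ‖x t‖ + m)
    (hgap : cubicModel T b ρ s + ε < cubicModel T b ρ (x t)) :
    ‖x (t + 1) - s‖ ^ 2 ≤ ‖x t - s‖ ^ 2 - 8 / 15 * η * ε := by
  have hη := h.η_pos
  have hρ := h.ρ_pos
  have hdesc := h.cubicModel_step_add_le t
  have hmin' := hmin (x (t + 1))
  have hmodel := cubicModel_eq_of_cubicGrad_eq_zero h.symm hs (x t)
  have hin := inner_sub_cubicGrad hs (x t)
  have hray := mul_norm_sq_le_inner_apply h.symm h.apply_basis hm (x t - s)
  have h4 := norm_sq_sub_le_of_norm_le (hx t)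
  rw [h.step]
  set G := cubicGrad T b ρ (x t)
  set w := x t - s with hw
  have hexp : ‖x t - η • G - s‖ ^ 2 = ‖w‖ ^ 2 - 2 * η * ⟪w, G⟫_ℝ + η ^ 2 * ‖G‖ ^ 2 := by
    rw [sub_right_comm, norm_sub_sq_real, inner_smul_right, norm_smul, mul_pow, Real.norm_eq_abs,
      sq_abs]
    ring
  have h1 : -δ * ‖w‖ ^ 2 ≤ (ρ * ‖x t‖ + m) * ‖w‖ ^ 2 :=
    mul_le_mul_of_nonneg_right hsh (by positivity)
  have h2 : δ * ‖w‖ ^ 2 ≤ δ * (4 * ‖s‖ ^ 2) := mul_le_mul_of_nonneg_left h4 hδ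
  have h3 : 0 ≤ ρ * (‖s‖ - ‖x t‖) ^ 2 * (2 * ‖s‖ + ‖x t‖) := by positivity
  -- The difference of the two sides is `½⟪w, (T + ρ‖x t‖)w⟫` plus a nonnegative cubic term plus
  -- `ε/15`; the quadratic term is at least `-2δ‖s‖² ≥ -ε/15`.
  have hlow : cubicModel T b ρ (x t) - cubicModel T b ρ s - ε / 15 ≤ ⟪w, G⟫_ℝ := by
    rw [hin, hmodel]
    linarith
  have h5 : η * ‖G‖ ^ 2 ≤ 4 / 3 * (cubicModel T b ρ (x t) - cubicModel T b ρ s) := by linarith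
  -- With a gap above `ε`, `2 - 4/3 = 2/3` of it less `2ε/15` leaves `8ε/15`.
  have h6 : η * (8 / 15 * ε) ≤ η * (2 * ⟪w, G⟫_ℝ - η * ‖G‖ ^ 2) :=
    mul_le_mul_of_nonneg_left (by linarith) hη.le
  rw [hexp]
  linarith

/-- Sublinear rate of convergence, independent of the spectral gap. -/
lemma cubicModel_le_of_sublinear_rate (h : GradientRun T e lam b ρ β R η x)
    (hmin : ∀ z, cubicModel T b ρ s ≤ cubicModel T b ρ z)
    (hs : cubicGrad T b ρ s = 0) (hm : ∀ i, m ≤ lam i) (hg : 0 < ρ * ‖s‖ + m) {v : E}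
    (hv : ‖v‖ = 1) (hTv : T v = m • v) (hb : ⟪v, b⟫_ℝ ≠ 0) {ε : ℝ} (hε : 0 < ε)
    (hεK : 2 * ε < (β + 2 * ρ * ‖s‖) * ‖s‖ ^ 2) {t : ℕ}
    (ht : 6 * (Real.log (1 + (max (-m) 0) ^ 2 / (4 * ρ * |⟪v, b⟫_ℝ|)) +
      Real.log ((β + 2 * ρ * ‖s‖) * ‖s‖ ^ 2 / ε)) / (η * (ε / (10 * ‖s‖ ^ 2))) ≤ t) :
    cubicModel T b ρ (x t) ≤ cubicModel T b ρ s + ε := by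
  have hx := h.norm_le_norm_minimizer hs hm hg hv hTv hb
  have hρ := h.ρ_pos
  have hη := h.η_pos
  have hβ := h.β_nonneg
  have hspos : 0 < ‖s‖ ^ 2 := by
    by_contra h0
    have : ‖s‖ ^ 2 = 0 := le_antisymm (not_lt.1 h0) (sq_nonneg _)
    rw [this] at hεK
    linarith
  by_contra hgap
  rw [not_le] at hgap
  set K := (β + 2 * ρ * ‖s‖) * ‖s‖ ^ 2 with hK
  set g := ε / (10 * ‖s‖ ^ 2) with hgdef
  have hg0 : 0 < g := by positivity
  have hgε : g * (10 * ‖s‖ ^ 2) = ε := div_mul_cancel₀ _ (by positivity)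
  have hηg : η * g ≤ 1 := by
    have h1 : g ≤ β + ρ * R := by
      have h2 : ‖s‖ ^ 2 * (20 * g) ≤ ‖s‖ ^ 2 * (β + 2 * ρ * ‖s‖) := by linarith
      have h3 := le_of_mul_le_mul_left h2 hspos
      have h4 := mul_le_mul_of_nonneg_left (h.norm_minimizer_le hs) hρ.le
      linarith
    have := mul_le_mul_of_nonneg_left h1 hη.le
    linarith [h.η_le, mul_pos hη hg0]
  have hl : Real.log 2 ≤ Real.log (K / ε) :=
    Real.log_le_log (by norm_num) ((le_div_iff₀ hε).2 hεK.le)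
  have hl2 := Real.log_two_gt_d9
  obtain ⟨t₀, k, rfl, hsh, hk⟩ :=
    h.exists_growth_stage hv hTv hb hg0 (by linarith) (by linarith) ht
  have hdec : ∀ j ≤ k, ‖x (t₀ + j) - s‖ ^ 2 ≤ ‖x t₀ - s‖ ^ 2 - j * (8 / 15 * η * ε) := by
    intro j
    induction j with
    | zero => simp
    | succ j ih =>
      intro hj
      have hmono : ρ * ‖x t₀‖ ≤ ρ * ‖x (t₀ + j)‖ :=
        mul_le_mul_of_nonneg_left (h.norm_monotone (by omega)) hρ.le
      -- Values decrease along the run, so a gap above `ε` at the end persists at all earlier steps.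
      have hf : cubicModel T b ρ (x (t₀ + k)) ≤ cubicModel T b ρ (x (t₀ + j)) :=
        h.cubicModel_antitone (by omega)
      have h1 := h.norm_sq_sub_succ_le hs hmin hm hx (δ := g / 3) (ε := ε) (by positivity)
        (by linarith) (t := t₀ + j) (by linarith) (by linarith)
      have h2 := ih (by omega)
      rw [← add_assoc]
      push_cast
      linarith
  have hfin := hdec k le_rfl
  have h0 := norm_sq_sub_le_of_norm_le (hx t₀)
  -- The total drop is then at least `16‖s‖²`, but the squared distance starts at no more than
  -- `4‖s‖²`.
  have hk' : 3 ≤ k * (η * g) := by linarith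
  have h7 : (k : ℝ) * (8 / 15 * η * ε) = 16 / 3 * ‖s‖ ^ 2 * (k * (η * g)) := by
    rw [← hgε]
    ring
  rw [h7] at hfin
  have h8 := mul_le_mul_of_nonneg_left hk' hspos.le
  linarith [sq_nonneg ‖x (t₀ + k) - s‖]

end GradientRun

end Run

/-! ### Transfer to matrices and the final theorem. -/

lemma inner_op_comm {d : ℕ} {A : Matrix (Fin d) (Fin d) ℝ} (hA : A.IsSymm)
    (x y : EuclideanSpace ℝ (Fin d)) : ⟪op A x, y⟫_ℝ = ⟪x, op A y⟫_ℝ := by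
  have hH : A.IsHermitian := by rwa [Matrix.IsHermitian, Matrix.conjTranspose_eq_transpose_of_trivial]
  exact Matrix.isSymmetric_toEuclideanLin_iff.2 hH x y

lemma objective_eq_cubicModel {d : ℕ} (A : Matrix (Fin d) (Fin d) ℝ)
    (b : EuclideanSpace ℝ (Fin d)) (ρ : ℝ) : objective A b ρ = cubicModel (op A) b ρ := rfl

lemma gradientDescent_succ {d : ℕ} {A : Matrix (Fin d) (Fin d) ℝ} (hA : A.IsSymm)
    (b : EuclideanSpace ℝ (Fin d)) (ρ η : ℝ) (x₀ : EuclideanSpace ℝ (Fin d)) (t : ℕ) :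
    gradientDescent (objective A b ρ) η x₀ (t + 1) = gradientDescent (objective A b ρ) η x₀ t -
      η • cubicGrad (op A) b ρ (gradientDescent (objective A b ρ) η x₀ t) := by
  rw [gradientDescent, objective_eq_cubicModel,
    (hasGradientAt_cubicModel (inner_op_comm hA) b ρ _).gradient]

end CubicGD

open CubicGD

theorem theorem3p1 {d : ℕ}
    -- the problem data: a symmetric matrix `A`, a vector `b`, and `ρ > 0`
    (A : Matrix (Fin d) (Fin d) ℝ) (hA : A.IsSymm)
    (b : EuclideanSpace ℝ (Fin d)) (ρ : ℝ) (hρ : 0 < ρ)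
    -- any upper bound on `‖A‖_op`, in particular `β = ‖A‖_op`
    (β : ℝ) (hβ : ‖CubicGD.op A‖ ≤ β)
    -- the smallest eigenvalue and a corresponding unit eigenvector
    (lamMin : ℝ) (hlam : CubicGD.IsMinEigenvalue A lamMin)
    (vMin : EuclideanSpace ℝ (Fin d)) (hv : ‖vMin‖ = 1)
    (hAv : CubicGD.op A vMin = lamMin • vMin)
    (hb : inner ℝ vMin b ≠ 0)
    -- a global minimizer
    (s : EuclideanSpace ℝ (Fin d))
    (hs : ∀ x, CubicGD.objective A b ρ s ≤ CubicGD.objective A b ρ x)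
    -- initialization and step size
    (r : ℝ) (hr₀ : 0 ≤ r) (hr : r ≤ CubicGD.cauchyRadius A b ρ)
    (η : ℝ) (hη₀ : 0 < η) (hη : η ≤ 1 / (4 * (β + ρ * CubicGD.upperRadius β ρ b)))
    (ε : ℝ) (hε : 0 < ε)
    (t : ℕ)
    (ht : (CubicGD.tauGrow lamMin ρ (inner ℝ vMin b) + CubicGD.tauConverge β ρ ‖s‖ ε) / η
        * min (1 / (ρ * ‖s‖ + lamMin)) (10 * ‖s‖ ^ 2 / ε) ≤ (t : ℝ)) :
    CubicGD.objective A b ρ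
        (CubicGD.gradientDescent (CubicGD.objective A b ρ) η (-(r / ‖b‖) • b) t)
      ≤ CubicGD.objective A b ρ s + ε := by
  have hT := inner_op_comm hA
  have hsymm : (Matrix.toEuclideanLin A).IsSymmetric := fun x y => hT x y
  have hfr : Module.finrank ℝ (EuclideanSpace ℝ (Fin d)) = d := finrank_euclideanSpace_fin
  have hb0 : b ≠ 0 := fun h => hb (by rw [h, inner_zero_right])
  have hβ0 : 0 ≤ β := (norm_nonneg _).trans hβ
  have hbpos : 0 < ‖b‖ := norm_pos_iff.2 hb0
  have hRpos : 0 < upperRadius β ρ b := by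
    unfold upperRadius
    have : 0 < √((β / (2 * ρ)) ^ 2 + ‖b‖ / ρ) := Real.sqrt_pos.2 (by positivity)
    positivity
  have he : ∀ i, op A (hsymm.eigenvectorBasis hfr i)
      = hsymm.eigenvalues hfr i • hsymm.eigenvectorBasis hfr i := fun i =>
    hsymm.apply_eigenvectorBasis hfr i
  have hm : ∀ i, lamMin ≤ hsymm.eigenvalues hfr i := fun i =>
    hlam.2 (hsymm.hasEigenvalue_eigenvalues hfr i)
  have hrun : GradientRun (op A) (hsymm.eigenvectorBasis hfr) (hsymm.eigenvalues hfr) b ρ β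
      (upperRadius β ρ b) η (gradientDescent (objective A b ρ) η (-(r / ‖b‖) • b)) :=
    { symm := hT
      apply_basis := he
      ρ_pos := hρ
      opNorm_le := hβ
      radius_eq := rfl
      η_pos := hη₀
      η_le := by
        rw [le_div_iff₀ (by positivity)] at hη
        linarith
      start := descentInvariant_start hT he hρ hb0 hr₀ hr
      start_eq := ⟨r / ‖b‖, by positivity, rfl⟩
      step := gradientDescent_succ hA b ρ η _ }
  rw [objective_eq_cubicModel] at hs hrun ⊢
  have hgrad := cubicGrad_eq_zero_of_isMinOn hT hs
  have hg := shifted_eigenvalue_pos hT hs hv hAv hb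
  -- For large `ε` the logarithm in `τ_converge` gives no usable lower bound, but every iterate
  -- already meets the tolerance.
  rcases le_or_gt ((β + 2 * ρ * ‖s‖) * ‖s‖ ^ 2) (2 * ε) with hK | hK
  · have h1 := (hrun.invariant t).cubicModel_nonpos hT he hρ.le
    have h2 := hrun.neg_cubicModel_minimizer_le hgrad
    linarith
  unfold tauGrow tauConverge at ht
  rw [← mul_add] at ht
  rcases min_choice (1 / (ρ * ‖s‖ + lamMin)) (10 * ‖s‖ ^ 2 / ε) with hmin | hmin
  · rw [hmin, div_mul_div_comm, mul_one] at ht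
    exact hrun.cubicModel_le_of_linear_rate hgrad hm hg hv hAv hb hε hK ht
  · rw [hmin, ← inv_div ε (10 * _), ← div_eq_mul_inv, div_div] at ht
    exact hrun.cubicModel_le_of_sublinear_rate hs hgrad hm hg hv hAv hb hε hK ht
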